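/- Theorem 4 (Poincaré recurrence theorem). Let $(M,\omega)$ be a symplectic manifold of finite dimension $2n$ (smooth, Hausdorff, second countable, without boundary; $\omega$ a smooth closed nondegenerate 2-form), let $\mu$ be its Liouville measure, given in local coordinates by $\sqrt{\det(\omega(\partial_i,\partial_j))}\,dx^1\cdots dx^{2n}$ (that is, $dq^1dp_1\cdots dq^ndp_n$ in canonical coordinates), and let $H:M\to\mathbb{R}$ be a $C^2$ Hamiltonian with Hamiltonian vector field $X_H$ determined by $\omega(X_H,\cdot)=dH$. Let $E\in\mathbb{R}$, $\delta E>0$, and suppose that the energy band $B=\{x\in M: E<H(x)<E+\delta E\}$ satisfies $\mu(B)<\infty$. Let $\tau>0$, suppose that for every $x\in B$ the solution of $\dot\gamma=X_H(\gamma)$ with $\gamma(0)=x$ exists on $[0,\tau]$, and write $U(x)=\gamma(\tau)$. Then $U$ maps $B$ into $B$, and the restricted dynamical system $(B,\mu|_B,U|_B)$ is recurrent in volume: for every measurable set $S\subseteq B$, the set of points $x\in S$ with $U^k(x)\notin S$ for all integers $k\ge 1$ has $\mu$-measure zero. -/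

import Mathlib

open Set MeasureTheory
open scoped Manifold ContDiff

noncomputable section

/-- A dynamical system with state space `S`, evolution rule `U` and volume `μ` is *recurrent in
volume* if, for every measurable `A ⊆ S`, the set of points of `A` that never re-enter `A` at a
later time step has measure zero. -/
def RecurrentInVolume {S : Type*} [MeasurableSpace S] (μ : Measure S) (U : S → S) : Prop :=
  ∀ A : Set S, MeasurableSet A → μ {x | x ∈ A ∧ ∀ k : ℕ, 0 < k → U^[k] x ∉ A} = 0

/-- The coordinate expression, in a chart `φ`, of a field `σ` of alternating 2-forms on a manifold:
the pullback of `σ` along `φ.symm`. It is meaningful on `φ.target`. -/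
def coordForm {d : ℕ} {M : Type*} [TopologicalSpace M] [ChartedSpace (EuclideanSpace ℝ (Fin d)) M]
    (σ : ∀ x : M, TangentSpace (𝓡 d) x [⋀^Fin 2]→L[ℝ] ℝ)
    (φ : OpenPartialHomeomorph M (EuclideanSpace ℝ (Fin d))) (y : EuclideanSpace ℝ (Fin d)) :
    EuclideanSpace ℝ (Fin d) [⋀^Fin 2]→L[ℝ] ℝ :=
  (σ (φ.symm y)).compContinuousLinearMap
    (mfderiv (𝓡 d) (𝓡 d) φ.symm y :
      EuclideanSpace ℝ (Fin d) →L[ℝ] TangentSpace (𝓡 d) (φ.symm y))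

/-- A symplectic form on a manifold: a smooth, closed, nondegenerate differential 2-form. -/
structure SymplecticForm (d : ℕ) (M : Type*) [TopologicalSpace M]
    [ChartedSpace (EuclideanSpace ℝ (Fin d)) M] where
  /-- the value of the form at each point -/
  toFun : ∀ x : M, TangentSpace (𝓡 d) x [⋀^Fin 2]→L[ℝ] ℝ
  smooth : ∀ φ ∈ atlas (EuclideanSpace ℝ (Fin d)) M, ContDiffOn ℝ ∞ (coordForm toFun φ) φ.target
  closed : ∀ φ ∈ atlas (EuclideanSpace ℝ (Fin d)) M, ∀ y ∈ φ.target,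
    extDeriv (coordForm toFun φ) y = 0
  nondegenerate : ∀ (x : M) (v : TangentSpace (𝓡 d) x), (∀ w, toFun x ![v, w] = 0) → v = 0

namespace SymplecticForm

variable {d : ℕ} {M : Type*} [TopologicalSpace M] [ChartedSpace (EuclideanSpace ℝ (Fin d)) M]

/-- The linear map `v ↦ σ(v, ·)` from the tangent space at `x` to its dual. -/
def flat (σ : SymplecticForm d M) (x : M) :
    TangentSpace (𝓡 d) x →ₗ[ℝ] Module.Dual ℝ (TangentSpace (𝓡 d) x) :=
  LinearMap.mk₂ ℝ (fun v w => σ.toFun x ![v, w])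
    (fun v₁ v₂ w => (σ.toFun x).toMultilinearMap.cons_add ![w] v₁ v₂)
    (fun c v w => (σ.toFun x).toMultilinearMap.cons_smul ![w] c v)
    (fun v w₁ w₂ => by
      have h (u : TangentSpace (𝓡 d) x) : Function.update ![v, 0] 1 u = ![v, u] := by
        ext i; fin_cases i <;> rfl
      have := (σ.toFun x).map_update_add ![v, 0] 1 w₁ w₂
      rwa [h, h, h] at this)
    (fun c v w => by
      have h (u : TangentSpace (𝓡 d) x) : Function.update ![v, 0] 1 u = ![v, u] := by
        ext i; fin_cases i <;> rfl
      have := (σ.toFun x).map_update_smul ![v, 0] 1 c w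
      rwa [h, h] at this)

instance finiteDimensional_tangentSpace (x : M) :
    FiniteDimensional ℝ (TangentSpace (𝓡 d) x) :=
  inferInstanceAs (FiniteDimensional ℝ (EuclideanSpace ℝ (Fin d)))

theorem flat_injective (σ : SymplecticForm d M) (x : M) : Function.Injective (σ.flat x) :=
  (injective_iff_map_eq_zero _).2 fun v hv =>
    σ.nondegenerate x v fun w => LinearMap.congr_fun hv w

/-- The Hamiltonian vector field `X_H` of `H`, determined by `σ(X_H, ·) = dH`. For
`σ = ∑ dqⁱ ∧ dpᵢ` its integral curves are the solutions of Hamilton's equations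
`dqⁱ/dt = ∂H/∂pᵢ`, `dpᵢ/dt = -∂H/∂qⁱ`. -/
def hamiltonianVectorField (σ : SymplecticForm d M) (H : M → ℝ) (x : M) :
    TangentSpace (𝓡 d) x :=
  ((σ.flat x).linearEquivOfInjective (σ.flat_injective x) Subspace.dual_finrank_eq.symm).symm
    (mfderiv (𝓡 d) 𝓘(ℝ, ℝ) H x : TangentSpace (𝓡 d) x →L[ℝ] ℝ).toLinearMap

theorem apply_hamiltonianVectorField (σ : SymplecticForm d M) (H : M → ℝ) (x : M)
    (w : TangentSpace (𝓡 d) x) :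
    σ.toFun x ![σ.hamiltonianVectorField H x, w] = mfderiv (𝓡 d) 𝓘(ℝ, ℝ) H x w :=
  LinearMap.congr_fun (((σ.flat x).linearEquivOfInjective (σ.flat_injective x)
    Subspace.dual_finrank_eq.symm).apply_symm_apply
    (mfderiv (𝓡 d) 𝓘(ℝ, ℝ) H x : TangentSpace (𝓡 d) x →L[ℝ] ℝ).toLinearMap) w

/-- The matrix `σ(∂ᵢ, ∂ⱼ)` of the symplectic form in the chart `φ`. -/
def coordMatrix (σ : SymplecticForm d M)
    (φ : OpenPartialHomeomorph M (EuclideanSpace ℝ (Fin d))) (y : EuclideanSpace ℝ (Fin d)) :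
    Matrix (Fin d) (Fin d) ℝ :=
  Matrix.of fun i j => coordForm σ.toFun φ y
    ![EuclideanSpace.single i (1 : ℝ), EuclideanSpace.single j (1 : ℝ)]

/-- The Liouville measure: the volume of the top exterior power of `σ` (divided by `n!` if
`d = 2 * n`). In each chart it is Lebesgue measure times the density `√(det (σ(∂ᵢ, ∂ⱼ)))`, so it is
`dq¹ dp₁ ⋯ dqⁿ dpₙ` in canonical coordinates. The local measures agree where charts overlap, and
the measure is obtained by gluing them, as the smallest measure that is at least each of them. -/
def liouvilleMeasure [MeasurableSpace M] (σ : SymplecticForm d M) : Measure M :=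
  ⨆ φ ∈ atlas (EuclideanSpace ℝ (Fin d)) M,
    Measure.map φ.symm ((volume.restrict φ.target).withDensity
      fun y => ENNReal.ofReal (Real.sqrt (σ.coordMatrix φ y).det))

/-- On the set `B`, the map `U` is the time-`τ` evolution under Hamilton's equations: for each
`x ∈ B` the solution starting at `x` exists up to time `τ`, and its position at time `τ`
is `U x`. -/
def IsTimeEvolutionOn (σ : SymplecticForm d M) (H : M → ℝ) (τ : ℝ) (U : M → M) (B : Set M) :
    Prop :=
  ∀ x ∈ B, ∃ γ : ℝ → M, γ 0 = x ∧
    IsMIntegralCurveOn (I := 𝓡 d) γ (σ.hamiltonianVectorField H) (Icc 0 τ) ∧ γ τ = U x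

end SymplecticForm

/-- The part of phase space with energies in the open band `(E, E + δE)`. -/
def energyBand {M : Type*} (H : M → ℝ) (E δE : ℝ) : Set M := {x | H x ∈ Ioo E (E + δE)}

end

/-! Energy is constant along solutions because dH(X_H) = σ(X_H, X_H) = 0, so `U` carries the band
into itself. Uniqueness of integral curves, read backwards from time τ, makes `U` injective there.

The heart is Liouville's theorem. Since dσ = 0 and σ(X_H, ·) = dH is exact, Cartan's formula gives a
vanishing Lie derivative (`lieDerivative_eq_zero_of_hamiltonian`). The flow of the C¹ field X_H is
differentiable in the initial point, its derivative solving the linearised equation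
(`exists_local_flow_hasFDerivAt`). Hence the flow pulls σ back to itself
(`toBilin_linearised_flow_eq`), and since √det scales by the Jacobian, it preserves Liouville
measure for short times inside a chart. Compactness of [0, τ] propagates this along each trajectory,
and a countable cover together with injectivity patches the local statements into μ(U(C)) = μ(C) for
measurable C in the band.

Solutions are not assumed to extend backwards, so `U` may fail to be onto. Finite volume repairs
this: U(B) has the volume of B, hence misses only a null set, and preservation for images becomes
preservation for preimages. A measure-preserving map of a finite measure space is conservative,
hence recurrent. -/

open scoped NNReal Topology

/-! ### Differentiability of a flow in the initial point -/

section Flow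

variable {E : Type*} [NormedAddCommGroup E] [NormedSpace ℝ E]

/-- Picard–Lindelöf with the information that the solution stays in the ball. -/
theorem IsPicardLindelof.exists_solution_mem_closedBall [CompleteSpace E] {f : ℝ → E → E}
    {tmin tmax : ℝ} {t₀ : Icc tmin tmax} {x₀ x : E} {a r L K : ℝ≥0}
    (hf : IsPicardLindelof f t₀ x₀ a r L K) (hx : x ∈ Metric.closedBall x₀ r) :
    ∃ α : ℝ → E, α t₀ = x ∧ (∀ t, α t ∈ Metric.closedBall x₀ a) ∧
      ∀ t ∈ Icc tmin tmax, HasDerivWithinAt α (f t (α t)) (Icc tmin tmax) t := by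
  obtain ⟨α, hα⟩ := ODE.FunSpace.exists_isFixedPt_next hf hx
  refine ⟨α.compProj, by rw [ODE.FunSpace.compProj_val, ← hα, ODE.FunSpace.next_apply₀],
    fun t => α.compProj_mem_closedBall hf.mul_max_le, fun t ht ↦ ?_⟩
  apply ODE.hasDerivWithinAt_picard_Icc t₀.2 hf.continuousOn_uncurry
    α.continuous_compProj.continuousOn (fun _ ht' ↦ α.compProj_mem_closedBall hf.mul_max_le)
    x ht |>.congr_of_mem _ ht
  intro t' ht'
  nth_rw 1 [← hα]
  rw [ODE.FunSpace.compProj_of_mem ht', ODE.FunSpace.next_apply]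

theorem HasDerivWithinAt.Ici_of_Icc {F : Type*} [NormedAddCommGroup F] [NormedSpace ℝ F]
    {f : ℝ → F} {f' : F} {a b t : ℝ}
    (h : HasDerivWithinAt f f' (Icc a b) t) (ht : t ∈ Ico a b) :
    HasDerivWithinAt f f' (Ici t) t :=
  h.mono_of_mem_nhdsWithin <| Filter.mem_of_superset (Icc_mem_nhdsGE ht.2)
    (Icc_subset_Icc_left ht.1)

theorem HasDerivWithinAt.Iic_of_Icc {F : Type*} [NormedAddCommGroup F] [NormedSpace ℝ F]
    {f : ℝ → F} {f' : F} {a b t : ℝ}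
    (h : HasDerivWithinAt f f' (Icc a b) t) (ht : t ∈ Ioc a b) :
    HasDerivWithinAt f f' (Iic t) t :=
  h.mono_of_mem_nhdsWithin <| Filter.mem_of_superset (Icc_mem_nhdsLE ht.1)
    (Icc_subset_Icc_right ht.2)

/-- First order expansion of a `C¹` map, uniformly over a compact convex set. -/
theorem exists_uniform_linear_approx {F : Type*} [NormedAddCommGroup F] [NormedSpace ℝ F]
    {f : E → F} {f' : E → E →L[ℝ] F} {s : Set E}
    (hs : IsCompact s) (hc : Convex ℝ s) (hf : ∀ x ∈ s, HasFDerivAt f (f' x) x)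
    (hf' : ContinuousOn f' s) {η : ℝ} (hη : 0 < η) :
    ∃ δ > 0, ∀ x ∈ s, ∀ y ∈ s, dist y x < δ → ‖f y - f x - f' x (y - x)‖ ≤ η * ‖y - x‖ := by
  obtain ⟨δ, hδ, h⟩ := Metric.uniformContinuousOn_iff.1
    (hs.uniformContinuousOn_of_continuous hf') η hη
  refine ⟨δ, hδ, fun x hx y hy hxy => ?_⟩
  have hseg : segment ℝ x y ⊆ s := hc.segment_subset hx hy
  refine (convex_segment x y).norm_image_sub_le_of_norm_hasFDerivWithin_le'
    (fun z hz => (hf z (hseg hz)).hasFDerivWithinAt) (fun z hz => ?_)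
    (left_mem_segment ℝ x y) (right_mem_segment ℝ x y)
  rw [← dist_eq_norm]
  refine (h z (hseg hz) x hx ?_).le
  have hz' : z ∈ Metric.ball x δ :=
    (convex_ball x δ).segment_subset (Metric.mem_ball_self hδ) (Metric.mem_ball.2 hxy) hz
  exact Metric.mem_ball.1 hz'

/-- The flow of a `C¹` vector field is differentiable in the initial point, with derivative the
solution of the linearised equation. -/
theorem hasFDerivAt_flow {X : E → E} {X' : E → E →L[ℝ] E} {s : Set E}
    (hs : IsCompact s) (hc : Convex ℝ s) (hX : ∀ x ∈ s, HasFDerivAt X (X' x) x)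
    (hX' : ContinuousOn X' s) {L : ℝ≥0} (hL : 0 < L) (hbound : ∀ x ∈ s, ‖X' x‖ ≤ L) {T : ℝ}
    {Φ : E → ℝ → E} {W : Set E} (h0 : ∀ y ∈ W, Φ y 0 = y)
    (hmem : ∀ y ∈ W, ∀ t ∈ Icc 0 T, Φ y t ∈ s)
    (hΦ : ∀ y ∈ W, ∀ t ∈ Icc 0 T, HasDerivWithinAt (Φ y) (X (Φ y t)) (Icc 0 T) t)
    {y : E} (hy : W ∈ 𝓝 y) {V : ℝ → E →L[ℝ] E} (hV0 : V 0 = .id ℝ E)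
    (hV : ∀ t ∈ Icc 0 T, HasDerivWithinAt V ((X' (Φ y t)).comp (V t)) (Icc 0 T) t)
    {t : ℝ} (ht : t ∈ Icc 0 T) : HasFDerivAt (fun z => Φ z t) (V t) y := by
  have hyW : y ∈ W := mem_of_mem_nhds hy
  have hlip : LipschitzOnWith L X s :=
    hc.lipschitzOnWith_of_nnnorm_hasFDerivWithin_le (fun x hx => (hX x hx).hasFDerivWithinAt)
      fun x hx => hbound x hx
  have hcont (z) (hz : z ∈ W) : ContinuousOn (Φ z) (Icc 0 T) :=
    fun t ht => (hΦ z hz t ht).continuousWithinAt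
  set C : ℝ := Real.exp (L * T) with hC
  have hCpos : 0 < C := Real.exp_pos _
  have hdist (z) (hz : z ∈ W) (u) (hu : u ∈ Icc 0 T) : dist (Φ z u) (Φ y u) ≤ C * dist z y := by
    have := dist_le_of_trajectories_ODE_of_mem (v := fun _ => X) (s := fun _ => s) (K := L)
      (a := 0) (b := T) (f := Φ z) (g := Φ y) (δ := dist z y) (fun _ _ => hlip) (hcont z hz)
      (fun t ht => (hΦ z hz t (Ico_subset_Icc_self ht)).Ici_of_Icc ht)
      (fun t ht => hmem z hz t (Ico_subset_Icc_self ht)) (hcont y hyW)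
      (fun t ht => (hΦ y hyW t (Ico_subset_Icc_self ht)).Ici_of_Icc ht)
      (fun t ht => hmem y hyW t (Ico_subset_Icc_self ht)) (by rw [h0 z hz, h0 y hyW]) u hu
    refine this.trans ?_
    rw [mul_comm, hC]
    have hu2 := hu.2
    gcongr
    linarith
  rw [hasFDerivAt_iff_isLittleO, Asymptotics.isLittleO_iff]
  intro c hc0
  -- `C` bounds the spreading of trajectories and `G` is the Grönwall factor of a constant forcing.
  -- With Taylor tolerance c / (C (G + 1)) the final error is c ‖z - y‖ G / (G + 1); the + 1 covers
  -- G = 0.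
  set G : ℝ := (Real.exp (L * t) - 1) / L with hG
  have hG0 : 0 ≤ G := by
    have : 1 ≤ Real.exp (L * t) := Real.one_le_exp (mul_nonneg L.2 ht.1)
    have hL' : (0 : ℝ) < L := hL
    rw [hG]; apply div_nonneg _ hL'.le; linarith
  obtain ⟨δ, hδ, happ⟩ := exists_uniform_linear_approx hs hc hX hX'
    (η := c / (C * (G + 1))) (by positivity)
  filter_upwards [hy, Metric.ball_mem_nhds y (ε := δ / C) (by positivity)] with z hz hzδ
  have hCz : C * dist z y < δ := by
    rw [Metric.mem_ball, lt_div_iff₀ hCpos] at hzδ; linarith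
  -- Grönwall for the first-order remainder: its derivative is X'(Φ y u) applied to the remainder
  -- itself, plus the Taylor error of `X` between the two trajectories.
  have key := norm_le_gronwallBound_of_norm_deriv_right_le (a := 0) (b := T)
    (f := fun u => Φ z u - Φ y u - V u (z - y))
    (f' := fun u => X (Φ z u) - X (Φ y u) - X' (Φ y u) (V u (z - y)))
    (δ := 0) (K := L) (ε := c / (C * (G + 1)) * (C * dist z y))
    (((hcont z hz).sub (hcont y hyW)).sub
      (fun u hu => ((hV u hu).continuousWithinAt.clm_apply continuousWithinAt_const)))
    (fun u hu => by
      have hu' := Ico_subset_Icc_self hu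
      have h1 := (((hΦ z hz u hu').sub (hΦ y hyW u hu')).sub
        ((hV u hu').clm_apply (hasDerivWithinAt_const u (Icc 0 T) (z - y))))
      exact (h1.Ici_of_Icc hu).congr_deriv (by simp))
    (by simp [h0 z hz, h0 y hyW, hV0])
    (fun u hu => by
      have hu' := Ico_subset_Icc_self hu
      have e : X (Φ z u) - X (Φ y u) - X' (Φ y u) (V u (z - y))
          = (X (Φ z u) - X (Φ y u) - X' (Φ y u) (Φ z u - Φ y u))
            + X' (Φ y u) (Φ z u - Φ y u - V u (z - y)) := by
        simp only [map_sub]; abel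
      rw [e, add_comm]
      refine (norm_add_le _ _).trans (add_le_add ?_ ?_)
      · exact ((X' _).le_opNorm _).trans
          (mul_le_mul_of_nonneg_right (hbound _ (hmem y hyW u hu')) (norm_nonneg _))
      · refine (happ _ (hmem y hyW u hu') _ (hmem z hz u hu')
          ((hdist z hz u hu').trans_lt hCz)).trans ?_
        rw [← dist_eq_norm]
        have := hdist z hz u hu'
        gcongr) t ht
  refine key.trans ?_
  rw [gronwallBound_of_K_ne_0 (by exact_mod_cast hL.ne')]
  simp only [zero_mul, zero_add, sub_zero]
  have hL' : (0 : ℝ) < L := hL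
  calc c / (C * (G + 1)) * (C * dist z y) / L * (Real.exp (L * t) - 1)
      = c * dist z y * (G / (G + 1)) := by rw [hG]; field_simp
    _ ≤ c * dist z y * 1 := by
        gcongr
        rw [div_le_one (by positivity)]; linarith
    _ = c * ‖z - y‖ := by rw [mul_one, dist_eq_norm]

/-- A `C¹` vector field on an open subset of a finite-dimensional space has a local flow that is
differentiable in the initial point, and its derivative solves the linearised equation. -/
theorem exists_local_flow_hasFDerivAt [FiniteDimensional ℝ E] {X : E → E} {Ω : Set E}
    (hΩ : IsOpen Ω) (hX : ContDiffOn ℝ 1 X Ω) {p : E} (hp : p ∈ Ω) :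
    ∃ W : Set E, IsOpen W ∧ p ∈ W ∧ ∃ T > 0, ∃ (Φ : E → ℝ → E) (V : E → ℝ → E →L[ℝ] E)
      (s : Set E) (L : ℝ≥0), s ⊆ Ω ∧ LipschitzOnWith L X s ∧
      ∀ y ∈ W, Φ y 0 = y ∧ V y 0 = .id ℝ E ∧ ∀ t ∈ Icc 0 T, Φ y t ∈ s ∧
        HasDerivWithinAt (Φ y) (X (Φ y t)) (Icc 0 T) t ∧
        HasDerivWithinAt (V y) ((fderiv ℝ X (Φ y t)).comp (V y t)) (Icc 0 T) t ∧
        HasFDerivAt (fun z => Φ z t) (V y t) y := by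
  have : CompleteSpace E := FiniteDimensional.complete ℝ E
  have : ProperSpace E := FiniteDimensional.proper ℝ E
  obtain ⟨R, hR, hRΩ⟩ := Metric.nhds_basis_closedBall.mem_iff.1 (hΩ.mem_nhds hp)
  set s := Metric.closedBall p R with hsdef
  have hs : IsCompact s := isCompact_closedBall p R
  have hc : Convex ℝ s := convex_closedBall p R
  have hd : ∀ x ∈ s, HasFDerivAt X (fderiv ℝ X x) x := fun x hx =>
    ((hX.differentiableOn one_ne_zero).differentiableAt (hΩ.mem_nhds (hRΩ hx))).hasFDerivAt
  have hd' : ContinuousOn (fderiv ℝ X) s :=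
    (hX.continuousOn_fderiv_of_isOpen hΩ le_rfl).mono hRΩ
  obtain ⟨L₀, hL₀⟩ := hs.exists_bound_of_continuousOn hd'
  obtain ⟨N₀, hN₀⟩ := hs.exists_bound_of_continuousOn (hX.continuousOn.mono hRΩ)
  set L : ℝ≥0 := ⟨max L₀ 1, by positivity⟩ with hL
  set N : ℝ≥0 := ⟨max N₀ 1, by positivity⟩ with hN
  have hLb : ∀ x ∈ s, ‖fderiv ℝ X x‖ ≤ L := fun x hx => (hL₀ x hx).trans (le_max_left _ _)
  have hNb : ∀ x ∈ s, ‖X x‖ ≤ N := fun x hx => (hN₀ x hx).trans (le_max_left _ _)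
  have hLpos : (0 : ℝ) < L := lt_of_lt_of_le one_pos (le_max_right _ _)
  have hNpos : (0 : ℝ) < N := lt_of_lt_of_le one_pos (le_max_right _ _)
  have hlip : LipschitzOnWith L X s :=
    hc.lipschitzOnWith_of_nnnorm_hasFDerivWithin_le (fun x hx => (hd x hx).hasFDerivWithinAt)
      fun x hx => hLb x hx
  -- The first bound keeps solutions starting within R / 2 of `p` in the ball of radius R. The
  -- second keeps the linearised solution within 1 of the identity, where operators have norm at
  -- most 2 and the linearised field is bounded by 2L.
  set T : ℝ := min (R / 2 / N) (1 / (2 * L)) with hT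
  have hTpos : 0 < T := by positivity
  have hTN : N * T ≤ R / 2 := by
    have : T ≤ R / 2 / N := min_le_left _ _
    rw [le_div_iff₀ hNpos] at this; linarith
  have hTL : (2 * L) * T ≤ 1 := by
    have : T ≤ 1 / (2 * L) := min_le_right _ _
    rw [le_div_iff₀ (by positivity)] at this; linarith
  let t₀ : Icc (0 : ℝ) T := ⟨0, left_mem_Icc.2 hTpos.le⟩
  have hpic : IsPicardLindelof (fun _ => X) t₀ p ⟨R, hR.le⟩ ⟨R / 2, by positivity⟩ N L :=
    .of_time_independent hNb hlip (by
      change (N : ℝ) * max (T - 0) (0 - 0) ≤ R - R / 2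
      rw [sub_zero, sub_zero, max_eq_left hTpos.le]; linarith)
  have hex : ∀ y : E, ∃ α : ℝ → E, y ∈ Metric.closedBall p (R / 2) → α 0 = y ∧ (∀ t, α t ∈ s) ∧
      ∀ t ∈ Icc 0 T, HasDerivWithinAt α (X (α t)) (Icc 0 T) t := by
    intro y
    by_cases hy : y ∈ Metric.closedBall p (R / 2)
    · obtain ⟨α, h⟩ := hpic.exists_solution_mem_closedBall hy
      exact ⟨α, fun _ => h⟩
    · exact ⟨0, fun h => absurd h hy⟩
  choose Φ hΦ using hex
  have hexV : ∀ y : E, ∃ V : ℝ → E →L[ℝ] E, y ∈ Metric.closedBall p (R / 2) → V 0 = .id ℝ E ∧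
      ∀ t ∈ Icc 0 T, HasDerivWithinAt V ((fderiv ℝ X (Φ y t)).comp (V t)) (Icc 0 T) t := by
    intro y
    by_cases hy : y ∈ Metric.closedBall p (R / 2)
    · obtain ⟨h0, h1, h2⟩ := hΦ y hy
      have hpicV : IsPicardLindelof (fun t (A : E →L[ℝ] E) => (fderiv ℝ X (Φ y t)).comp A)
          t₀ (.id ℝ E) 1 0 (2 * L) L := by
        refine ⟨fun t _ => ?_, fun A _ => ?_, fun t _ A hA => ?_, ?_⟩
        · refine LipschitzOnWith.of_dist_le_mul fun A _ B _ => ?_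
          rw [dist_eq_norm, dist_eq_norm, ← ContinuousLinearMap.comp_sub]
          exact (ContinuousLinearMap.opNorm_comp_le _ _).trans
            (mul_le_mul_of_nonneg_right (hLb _ (h1 t)) (norm_nonneg _))
        · refine ContinuousOn.clm_comp (hd'.comp ?_ fun t _ => h1 t) continuousOn_const
          exact fun t ht => (h2 t ht).continuousWithinAt
        · refine (ContinuousLinearMap.opNorm_comp_le _ _).trans ?_
          have hA1 : ‖A‖ ≤ 2 := by
            have h3 : ‖A - .id ℝ E‖ ≤ 1 := by simpa [dist_eq_norm] using hA
            have h4 : ‖ContinuousLinearMap.id ℝ E‖ ≤ 1 := ContinuousLinearMap.norm_id_le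
            have h5 := norm_sub_norm_le A (.id ℝ E)
            linarith
          have := mul_le_mul (hLb _ (h1 t)) hA1 (norm_nonneg _) hLpos.le
          push_cast; linarith
        · change ((2 * L : ℝ≥0) : ℝ) * max (T - 0) (0 - 0) ≤ 1 - 0
          rw [sub_zero, sub_zero, sub_zero, max_eq_left hTpos.le]; push_cast; linarith
      obtain ⟨V, hV0, hV⟩ := hpicV.exists_eq_forall_mem_Icc_hasDerivWithinAt₀
      exact ⟨V, fun _ => ⟨hV0, hV⟩⟩
    · exact ⟨0, fun h => absurd h hy⟩
  choose V hV using hexV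
  have hsub : Metric.ball p (R / 2) ⊆ Metric.closedBall p (R / 2) := Metric.ball_subset_closedBall
  refine ⟨Metric.ball p (R / 2), Metric.isOpen_ball, Metric.mem_ball_self (by positivity),
    T, hTpos, Φ, V, s, L, hRΩ, hlip, fun y hy => ⟨(hΦ y (hsub hy)).1, (hV y (hsub hy)).1, fun t ht =>
      ⟨(hΦ y (hsub hy)).2.1 t, (hΦ y (hsub hy)).2.2 t ht, (hV y (hsub hy)).2 t ht, ?_⟩⟩⟩
  exact hasFDerivAt_flow hs hc hd hd' (L := L) hLpos hLb
    (fun z hz => (hΦ z (hsub hz)).1) (fun z hz t _ => (hΦ z (hsub hz)).2.1 t)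
    (fun z hz => (hΦ z (hsub hz)).2.2) (Metric.isOpen_ball.mem_nhds hy) (hV y (hsub hy)).1
    (hV y (hsub hy)).2 ht

end Flow

noncomputable section

/-! ### Invariance of a closed 2-form under a Hamiltonian flow -/

section TwoForms

set_option maxSynthPendingDepth 3

variable {E : Type*} [NormedAddCommGroup E] [NormedSpace ℝ E]

/-- An alternating 2-form as a continuous bilinear map. -/
def ContinuousAlternatingMap.toBilin : (E [⋀^Fin 2]→L[ℝ] ℝ) →L[ℝ] E →L[ℝ] E →L[ℝ] ℝ :=
  (ContinuousLinearMap.compL ℝ E (E [⋀^Fin 1]→L[ℝ] ℝ) (E →L[ℝ] ℝ)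
    ((ContinuousAlternatingMap.ofSubsingletonLIE (𝕜 := ℝ) (E := E) (F := ℝ) (0 : Fin 1)).symm :
      (E [⋀^Fin 1]→L[ℝ] ℝ) →L[ℝ] (E →L[ℝ] ℝ))).comp
    (ContinuousAlternatingMap.curryLeftLI (𝕜 := ℝ) (E := E) (F := ℝ)
      (n := 1)).toContinuousLinearMap

open ContinuousAlternatingMap

theorem ContinuousAlternatingMap.toBilin_apply (w : E [⋀^Fin 2]→L[ℝ] ℝ) (u v : E) :
    toBilin w u v = w ![u, v] := by
  change w (Matrix.vecCons u (fun _ => v)) = _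
  congr 1
  ext i
  fin_cases i <;> rfl

theorem ContinuousAlternatingMap.toBilin_swap (w : E [⋀^Fin 2]→L[ℝ] ℝ) (u v : E) :
    toBilin w u v = - toBilin w v u := by
  rw [toBilin_apply, toBilin_apply]
  refine Eq.trans (congrArg w ?_) (w.toAlternatingMap.map_swap ![v, u] (i := 0) (j := 1) (by decide))
  ext i
  fin_cases i <;> rfl

theorem ContinuousAlternatingMap.contDiff_toBilin {n : WithTop ℕ∞} :
    ContDiff ℝ n fun w : E [⋀^Fin 2]→L[ℝ] ℝ => toBilin w :=
  ContinuousLinearMap.contDiff (F := E →L[ℝ] E →L[ℝ] ℝ) toBilin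

theorem ContinuousAlternatingMap.differentiableAt_toBilin {w : E [⋀^Fin 2]→L[ℝ] ℝ} :
    DifferentiableAt ℝ (fun w : E [⋀^Fin 2]→L[ℝ] ℝ => toBilin w) w :=
  (contDiff_toBilin (n := 1)).differentiable one_ne_zero w

/-- A closed 2-form is infinitesimally invariant under every vector field `X` for which `w(X, ·)` is
exact: the Lie derivative of `w` along `X` vanishes. -/
theorem lieDerivative_eq_zero_of_hamiltonian {w : E → E [⋀^Fin 2]→L[ℝ] ℝ} {h : E → ℝ} {X : E → E}
    {y : E} (hw : DifferentiableAt ℝ w y) (hcl : extDeriv w y = 0) (hh : ContDiffAt ℝ 2 h y)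
    (hX : DifferentiableAt ℝ X y) (heq : ∀ᶠ z in 𝓝 y, toBilin (w z) (X z) = fderiv ℝ h z)
    (a b : E) :
    fderiv ℝ (fun z => toBilin (w z)) y (X y) a b + toBilin (w y) (fderiv ℝ X y a) b
      + toBilin (w y) a (fderiv ℝ X y b) = 0 := by
  set D := fderiv ℝ (fun z => toBilin (w z)) y with hD
  have hB : HasFDerivAt (fun z => toBilin (w z)) D y :=
    (differentiableAt_toBilin.comp y hw).hasFDerivAt
  have hsymm : IsSymmSndFDerivAt ℝ h y := hh.isSymmSndFDerivAt (by simp)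
  -- Cartan's formula by hand: differentiate w(X, ·) = dh, antisymmetrise using the symmetry of D²h,
  -- and trade the two derivatives of `w` along `a` and `b` for the one along `X` by closedness.
  have hH (u v : E) : fderiv ℝ (fderiv ℝ h) y u v
      = D u (X y) v + toBilin (w y) (fderiv ℝ X y u) v := by
    have h1 := hB.clm_apply hX.hasFDerivAt
    have h2 := h1.congr_of_eventuallyEq (heq.mono fun z hz => hz.symm)
    rw [h2.fderiv]
    simp [add_comm]
  have hclosed : D (X y) a b - D a (X y) b + D b (X y) a = 0 := by
    have hf (c d : E) : fderiv ℝ (fun z => w z ![c, d]) y = (D.flip c).flip d := by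
      have h1 : HasFDerivAt (fun z => toBilin (w z) c d) ((D.flip c).flip d) y := by
        have := (hB.clm_apply (hasFDerivAt_const c y)).clm_apply (hasFDerivAt_const d y)
        refine this.congr_fderiv ?_
        ext u
        simp
      simp only [toBilin_apply] at h1
      exact h1.fderiv
    have h3 := extDeriv_apply hw ![X y, a, b]
    have e0 : (0 : Fin 3).removeNth ![X y, a, b] = ![a, b] := by
      ext i; fin_cases i <;> rfl
    have e1 : (1 : Fin 3).removeNth ![X y, a, b] = ![X y, b] := by
      ext i; fin_cases i <;> rfl
    have e2 : (2 : Fin 3).removeNth ![X y, a, b] = ![X y, a] := by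
      ext i; fin_cases i <;> rfl
    rw [hcl, Fin.sum_univ_three, e0, e1, e2, hf, hf, hf] at h3
    simp at h3
    linarith
  have h1 := hH a b
  have h2 := hH b a
  have h3 := hsymm a b
  have h4 := toBilin_swap (w y) a (fderiv ℝ X y b)
  linarith

/-- The linearised Hamiltonian flow preserves the symplectic form. -/
theorem toBilin_linearised_flow_eq {w : E → E [⋀^Fin 2]→L[ℝ] ℝ} {h : E → ℝ} {X : E → E}
    {Ω : Set E} (hΩ : IsOpen Ω)
    (hw : DifferentiableOn ℝ w Ω) (hcl : ∀ y ∈ Ω, extDeriv w y = 0) (hh : ContDiffOn ℝ 2 h Ω)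
    (hX : DifferentiableOn ℝ X Ω) (heq : ∀ y ∈ Ω, toBilin (w y) (X y) = fderiv ℝ h y)
    {T : ℝ} {x : ℝ → E} {V : ℝ → E →L[ℝ] E} (hxΩ : ∀ t ∈ Icc 0 T, x t ∈ Ω)
    (hx : ∀ t ∈ Icc 0 T, HasDerivWithinAt x (X (x t)) (Icc 0 T) t)
    (hV : ∀ t ∈ Icc 0 T, HasDerivWithinAt V ((fderiv ℝ X (x t)).comp (V t)) (Icc 0 T) t)
    (hV0 : V 0 = .id ℝ E) {t : ℝ} (ht : t ∈ Icc 0 T) (a b : E) :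
    toBilin (w (x t)) (V t a) (V t b) = toBilin (w (x 0)) a b := by
  have hderiv : ∀ t ∈ Icc 0 T,
      HasDerivWithinAt (fun t => toBilin (w (x t)) (V t a) (V t b)) 0 (Icc 0 T) t := by
    intro t ht
    have hn := hΩ.mem_nhds (hxΩ t ht)
    have hwd := hw.differentiableAt hn
    have hB : HasFDerivAt (fun z => toBilin (w z)) (fderiv ℝ (fun z => toBilin (w z)) (x t)) (x t) :=
      (differentiableAt_toBilin.comp (x t) hwd).hasFDerivAt
    have hVa (a : E) := (hV t ht).clm_apply (hasDerivWithinAt_const t (Icc 0 T) a)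
    have h1 := ((hB.comp_hasDerivWithinAt t (hx t ht)).clm_apply (hVa a)).clm_apply (hVa b)
    refine h1.congr_deriv ?_
    -- The product rule yields exactly the Lie derivative, evaluated on the transported vectors V t
    -- a and V t b.
    have := lieDerivative_eq_zero_of_hamiltonian hwd (hcl _ (hxΩ t ht))
      (hh.contDiffAt hn) (hX.differentiableAt hn)
      (Filter.mem_of_superset hn heq) (V t a) (V t b)
    simpa using this
  have := constant_of_has_deriv_right_zero (a := 0) (b := T)
    (fun t ht => (hderiv t ht).continuousWithinAt)
    (fun t ht => (hderiv t (Ico_subset_Icc_self ht)).Ici_of_Icc ht) t ht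
  simpa [hV0] using this

end TwoForms

/-! ### The volume density of a 2-form -/

section Density

variable {d : ℕ}

/-- The density `√(det w(∂ᵢ, ∂ⱼ))` of a 2-form on `ℝᵈ`. -/
def formDensity (w : EuclideanSpace ℝ (Fin d) [⋀^Fin 2]→L[ℝ] ℝ) : ENNReal :=
  ENNReal.ofReal (Real.sqrt (Matrix.of fun i j : Fin d =>
    w ![EuclideanSpace.single i (1 : ℝ), EuclideanSpace.single j (1 : ℝ)]).det)

/-- The Gram matrix G becomes JᵀGJ, so its determinant gains the square of det J, whose root is the
Jacobian factor of the change of variables. The sign of det G plays no role. -/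
theorem formDensity_compContinuousLinearMap
    (w : EuclideanSpace ℝ (Fin d) [⋀^Fin 2]→L[ℝ] ℝ)
    (J : EuclideanSpace ℝ (Fin d) →L[ℝ] EuclideanSpace ℝ (Fin d)) :
    formDensity (w.compContinuousLinearMap J) = ENNReal.ofReal |J.det| * formDensity w := by
  set b := (EuclideanSpace.basisFun (Fin d) ℝ).toBasis with hb
  let β (w : EuclideanSpace ℝ (Fin d) [⋀^Fin 2]→L[ℝ] ℝ) :
      EuclideanSpace ℝ (Fin d) →ₗ[ℝ] EuclideanSpace ℝ (Fin d) →ₗ[ℝ] ℝ :=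
    (ContinuousLinearMap.coeLM ℝ).comp (ContinuousAlternatingMap.toBilin w).toLinearMap
  have hβ (w : EuclideanSpace ℝ (Fin d) [⋀^Fin 2]→L[ℝ] ℝ) : (Matrix.of fun i j : Fin d =>
      w ![EuclideanSpace.single i (1 : ℝ), EuclideanSpace.single j (1 : ℝ)])
      = LinearMap.toMatrix₂ b b (β w) := by
    ext i j
    rw [LinearMap.toMatrix₂_apply]
    change _ = ContinuousAlternatingMap.toBilin w (b i) (b j)
    rw [ContinuousAlternatingMap.toBilin_apply]
    simp [hb]
  have hc : β (w.compContinuousLinearMap J) = (β w).compl₁₂ J.toLinearMap J.toLinearMap := by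
    refine LinearMap.ext₂ fun u v => ?_
    change ContinuousAlternatingMap.toBilin _ u v = ContinuousAlternatingMap.toBilin w (J u) (J v)
    rw [ContinuousAlternatingMap.toBilin_apply, ContinuousAlternatingMap.toBilin_apply]
    change w (J ∘ ![u, v]) = _
    congr 1
    ext i; fin_cases i <;> rfl
  rw [formDensity, formDensity, hβ, hβ, hc, LinearMap.toMatrix₂_compl₁₂ b b b b, Matrix.det_mul,
    Matrix.det_mul, Matrix.det_transpose, LinearMap.det_toMatrix, ← ENNReal.ofReal_mul (abs_nonneg _)]
  congr 1
  rw [mul_right_comm, ← pow_two, Real.sqrt_mul (sq_nonneg _), Real.sqrt_sq_eq_abs]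

/-- A differentiable injective map pulling `w₂` back to `w₁` preserves the associated volume. -/
theorem lintegral_image_formDensity
    {w₁ w₂ : EuclideanSpace ℝ (Fin d) → EuclideanSpace ℝ (Fin d) [⋀^Fin 2]→L[ℝ] ℝ}
    {f : EuclideanSpace ℝ (Fin d) → EuclideanSpace ℝ (Fin d)}
    {f' : EuclideanSpace ℝ (Fin d) → EuclideanSpace ℝ (Fin d) →L[ℝ] EuclideanSpace ℝ (Fin d)}
    {C : Set (EuclideanSpace ℝ (Fin d))} (hC : MeasurableSet C)
    (hf : ∀ y ∈ C, HasFDerivWithinAt f (f' y) C y) (hinj : InjOn f C)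
    (hw : ∀ y ∈ C, w₁ y = (w₂ (f y)).compContinuousLinearMap (f' y)) :
    ∫⁻ y in f '' C, formDensity (w₂ y) = ∫⁻ y in C, formDensity (w₁ y) := by
  rw [lintegral_image_eq_lintegral_abs_det_fderiv_mul volume hC hf hinj]
  refine setLIntegral_congr_fun hC fun y hy => ?_
  rw [hw y hy, formDensity_compContinuousLinearMap]

end Density

/-! ### The Liouville measure in charts -/

theorem OpenPartialHomeomorph.measurableSet_target_inter_preimage_symm {X Y : Type*}
    [TopologicalSpace X] [TopologicalSpace Y] [MeasurableSpace X] [BorelSpace X]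
    [MeasurableSpace Y] [BorelSpace Y] (φ : OpenPartialHomeomorph X Y) {C : Set X}
    (hC : MeasurableSet C) : MeasurableSet (φ.target ∩ φ.symm ⁻¹' C) := by
  have h := (continuousOn_iff_continuous_domRestrict.1 φ.continuousOn_symm).measurable hC
  have h' := MeasurableSet.subtype_image φ.open_target.measurableSet h
  convert h' using 1
  ext y
  simp [and_comm]

theorem OpenPartialHomeomorph.measurableSet_image {X Y : Type*}
    [TopologicalSpace X] [TopologicalSpace Y] [MeasurableSpace X] [BorelSpace X]
    [MeasurableSpace Y] [BorelSpace Y] (φ : OpenPartialHomeomorph X Y) {C : Set X}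
    (hC : MeasurableSet C) (hCs : C ⊆ φ.source) : MeasurableSet (φ '' C) := by
  rw [φ.image_eq_target_inter_inv_preimage hCs]
  exact φ.measurableSet_target_inter_preimage_symm hC

namespace SymplecticForm

section Measure

variable {d : ℕ} {M : Type*} [TopologicalSpace M] [ChartedSpace (EuclideanSpace ℝ (Fin d)) M]

/-- Change of charts for the coordinate expression of a 2-form. -/
theorem coordForm_comp_transition [IsManifold (𝓡 d) ∞ M]
    (σ : ∀ x : M, TangentSpace (𝓡 d) x [⋀^Fin 2]→L[ℝ] ℝ)
    {φ ψ : OpenPartialHomeomorph M (EuclideanSpace ℝ (Fin d))}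
    (hφ : φ ∈ atlas (EuclideanSpace ℝ (Fin d)) M) (hψ : ψ ∈ atlas (EuclideanSpace ℝ (Fin d)) M)
    {y : EuclideanSpace ℝ (Fin d)} (hy : y ∈ φ.target) (hy' : φ.symm y ∈ ψ.source) :
    DifferentiableAt ℝ (ψ ∘ φ.symm) y ∧
      coordForm σ φ y =
        (coordForm σ ψ (ψ (φ.symm y))).compContinuousLinearMap (fderiv ℝ (ψ ∘ φ.symm) y) := by
  have h1 := (mdifferentiableAt_atlas_symm (I := 𝓡 d) hφ hy).hasMFDerivAt
  have h2 := (mdifferentiableAt_atlas (I := 𝓡 d) hψ hy').hasMFDerivAt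
  have h3 := (mdifferentiableAt_atlas_symm (I := 𝓡 d) hψ (ψ.map_source hy')).hasMFDerivAt
  have hd : DifferentiableAt ℝ (ψ ∘ φ.symm) y :=
    (hasMFDerivAt_iff_hasFDerivAt.1 (h2.comp y h1)).differentiableAt
  have h321 := h3.comp y hd.hasFDerivAt.hasMFDerivAt
  refine ⟨hd, ?_⟩
  have heq : ψ.symm ∘ ψ ∘ φ.symm =ᶠ[𝓝 y] φ.symm := by
    have : φ.symm ⁻¹' ψ.source ∈ 𝓝 y :=
      (φ.continuousAt_symm hy).preimage_mem_nhds (ψ.open_source.mem_nhds hy')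
    filter_upwards [this] with z hz
    exact ψ.left_inv hz
  have hJ := hasMFDerivAt_unique h1 (h321.congr_of_eventuallyEq heq.symm)
  -- Tangent spaces are definitionally the model space; phrased there, the equality of base points
  -- can be rewritten although the types depend on them.
  have key (p q : M) (hpq : p = q)
      (A B : EuclideanSpace ℝ (Fin d) →L[ℝ] EuclideanSpace ℝ (Fin d)) (hAB : A = B) :
      ContinuousAlternatingMap.compContinuousLinearMap
        (σ p : EuclideanSpace ℝ (Fin d) [⋀^Fin 2]→L[ℝ] ℝ) A =
      ContinuousAlternatingMap.compContinuousLinearMap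
        (σ q : EuclideanSpace ℝ (Fin d) [⋀^Fin 2]→L[ℝ] ℝ) B := by
    rw [hAB, hpq]
  exact key _ _ (ψ.left_inv hy').symm _ _ hJ

/-- The Liouville measure of the domain of a chart, computed in that chart. -/
def chartMeasure [MeasurableSpace M] (σ : SymplecticForm d M)
    (φ : OpenPartialHomeomorph M (EuclideanSpace ℝ (Fin d))) : Measure M :=
  Measure.map φ.symm ((volume.restrict φ.target).withDensity
    fun y => formDensity (coordForm σ.toFun φ y))

theorem liouvilleMeasure_eq_iSup_chartMeasure [MeasurableSpace M] (σ : SymplecticForm d M) :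
    σ.liouvilleMeasure = ⨆ φ ∈ atlas (EuclideanSpace ℝ (Fin d)) M, σ.chartMeasure φ := rfl

theorem chartMeasure_apply [MeasurableSpace M] [BorelSpace M] (σ : SymplecticForm d M)
    (φ : OpenPartialHomeomorph M (EuclideanSpace ℝ (Fin d))) {C : Set M} (hC : MeasurableSet C) :
    σ.chartMeasure φ C =
      ∫⁻ y in φ '' (φ.source ∩ C), formDensity (coordForm σ.toFun φ y) := by
  -- Off `φ.target`, a null set here, `φ.symm` is arbitrary. So it is only a.e. measurable and the
  -- preimage of `C` need not be measurable, which `withDensity_apply'` tolerates.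
  have hm : AEMeasurable φ.symm ((volume.restrict φ.target).withDensity
      fun y => formDensity (coordForm σ.toFun φ y)) :=
    (φ.continuousOn_symm.aemeasurable φ.open_target.measurableSet).mono_ac
      (withDensity_absolutelyContinuous _ _)
  rw [chartMeasure, Measure.map_apply_of_aemeasurable hm hC, withDensity_apply',
    Measure.restrict_restrict' φ.open_target.measurableSet,
    φ.image_source_inter_eq', inter_comm]

/-- The transition map pulls one coordinate form back to the other, so the change of variables
formula applies. This compatibility is what lets the supremum over charts act as a gluing. -/
theorem chartMeasure_eq_of_subset [IsManifold (𝓡 d) ∞ M] [MeasurableSpace M] [BorelSpace M]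
    (σ : SymplecticForm d M)
    {φ ψ : OpenPartialHomeomorph M (EuclideanSpace ℝ (Fin d))}
    (hφ : φ ∈ atlas (EuclideanSpace ℝ (Fin d)) M) (hψ : ψ ∈ atlas (EuclideanSpace ℝ (Fin d)) M)
    {C : Set M} (hC : MeasurableSet C) (hCφ : C ⊆ φ.source) (hCψ : C ⊆ ψ.source) :
    σ.chartMeasure ψ C = σ.chartMeasure φ C := by
  rw [chartMeasure_apply σ φ hC, chartMeasure_apply σ ψ hC, inter_eq_right.2 hCφ,
    inter_eq_right.2 hCψ]
  have himg : ψ '' C = (ψ ∘ φ.symm) '' (φ '' C) := by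
    rw [image_image]
    exact image_congr fun x hx => by simp [φ.left_inv (hCφ hx)]
  rw [himg]
  refine lintegral_image_formDensity (φ.measurableSet_image hC hCφ)
    (f' := fun y => fderiv ℝ (ψ ∘ φ.symm) y) ?_ ?_ ?_
  · rintro _ ⟨x, hx, rfl⟩
    refine (coordForm_comp_transition σ.toFun hφ hψ
      (φ.map_source (hCφ hx)) ?_).1.hasFDerivAt.hasFDerivWithinAt
    rw [φ.left_inv (hCφ hx)]; exact hCψ hx
  · rintro _ ⟨x, hx, rfl⟩ _ ⟨x', hx', rfl⟩ h
    simp only [Function.comp_apply, φ.left_inv (hCφ hx), φ.left_inv (hCφ hx')] at h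
    rw [ψ.injOn (hCψ hx) (hCψ hx') h]
  · rintro _ ⟨x, hx, rfl⟩
    refine (coordForm_comp_transition σ.toFun hφ hψ (φ.map_source (hCφ hx)) ?_).2
    rw [φ.left_inv (hCφ hx)]; exact hCψ hx

/-- On the domain of a chart, the Liouville measure is the one computed in that chart. -/
theorem liouvilleMeasure_apply_of_subset [IsManifold (𝓡 d) ∞ M] [MeasurableSpace M] [BorelSpace M]
    (σ : SymplecticForm d M) {φ : OpenPartialHomeomorph M (EuclideanSpace ℝ (Fin d))}
    (hφ : φ ∈ atlas (EuclideanSpace ℝ (Fin d)) M) {C : Set M} (hC : MeasurableSet C)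
    (hCφ : C ⊆ φ.source) :
    σ.liouvilleMeasure C = ∫⁻ y in φ '' C, formDensity (coordForm σ.toFun φ y) := by
  have hchart : σ.chartMeasure φ C = ∫⁻ y in φ '' C, formDensity (coordForm σ.toFun φ y) := by
    rw [chartMeasure_apply σ φ hC, inter_eq_right.2 hCφ]
  have hle {ψ} (hψ : ψ ∈ atlas (EuclideanSpace ℝ (Fin d)) M) :
      σ.chartMeasure ψ ≤ σ.liouvilleMeasure := by
    rw [liouvilleMeasure_eq_iSup_chartMeasure]
    exact le_iSup₂ (f := fun φ (_ : φ ∈ atlas (EuclideanSpace ℝ (Fin d)) M) => σ.chartMeasure φ)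
      ψ hψ
  -- The right side dominates every chart measure: inside `φ.source` by agreement on overlaps,
  -- outside trivially. The supremum is the least such bound, and on `C` the second term vanishes.
  have hub : σ.liouvilleMeasure ≤
      σ.chartMeasure φ + σ.liouvilleMeasure.restrict φ.sourceᶜ := by
    conv_lhs => rw [liouvilleMeasure_eq_iSup_chartMeasure]
    refine iSup₂_le fun ψ hψ => Measure.le_iff.2 fun A hA => ?_
    have hs := φ.open_source.measurableSet
    rw [← measure_inter_add_sdiff A hs, Measure.add_apply, Measure.restrict_apply hA]
    refine add_le_add ?_ (hle hψ _)
    have hsplit : σ.chartMeasure ψ (A ∩ φ.source)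
        = σ.chartMeasure ψ (ψ.source ∩ (A ∩ φ.source)) := by
      rw [chartMeasure_apply σ ψ (hA.inter hs),
        chartMeasure_apply σ ψ (ψ.open_source.measurableSet.inter (hA.inter hs)),
        ← inter_assoc ψ.source ψ.source, inter_self]
    rw [hsplit, chartMeasure_eq_of_subset σ hφ hψ
      (ψ.open_source.measurableSet.inter (hA.inter hs)) (fun x hx => hx.2.2) (fun x hx => hx.1)]
    exact measure_mono fun x hx => hx.2.1
  refine le_antisymm ?_ ?_
  · rw [← hchart]
    refine (hub C).trans ?_
    rw [Measure.add_apply, Measure.restrict_apply hC, ← Set.sdiff_eq, sdiff_eq_empty.2 hCφ,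
      measure_empty, add_zero]
  · rw [← hchart]
    exact hle hφ C

end Measure

end SymplecticForm

/-! ### Integral curves in charts and their uniqueness -/

section ChartField

variable {d : ℕ} {M : Type*} [TopologicalSpace M] [ChartedSpace (EuclideanSpace ℝ (Fin d)) M]

/-- The coordinate expression of a vector field in a chart. -/
def chartField (v : ∀ x : M, TangentSpace (𝓡 d) x)
    (φ : OpenPartialHomeomorph M (EuclideanSpace ℝ (Fin d))) (y : EuclideanSpace ℝ (Fin d)) :
    EuclideanSpace ℝ (Fin d) :=
  (mfderiv (𝓡 d) (𝓡 d) φ (φ.symm y) (v (φ.symm y)) : TangentSpace (𝓡 d) (φ (φ.symm y)))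

theorem chartField_apply (v : ∀ x : M, TangentSpace (𝓡 d) x)
    (φ : OpenPartialHomeomorph M (EuclideanSpace ℝ (Fin d))) {x : M} (hx : x ∈ φ.source) :
    chartField v φ (φ x) = mfderiv (𝓡 d) (𝓡 d) φ x (v x) := by
  have key (p q : M) (h : p = q) :
      (mfderiv (𝓡 d) (𝓡 d) φ p (v p) : EuclideanSpace ℝ (Fin d))
        = (mfderiv (𝓡 d) (𝓡 d) φ q (v q) : EuclideanSpace ℝ (Fin d)) := by rw [h]
  exact key _ _ (φ.left_inv hx)

theorem IsMIntegralCurveOn.hasDerivWithinAt_chart [IsManifold (𝓡 d) ∞ M]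
    {v : ∀ x : M, TangentSpace (𝓡 d) x} {γ : ℝ → M} {s : Set ℝ}
    (hγ : IsMIntegralCurveOn (I := 𝓡 d) γ v s)
    {φ : OpenPartialHomeomorph M (EuclideanSpace ℝ (Fin d))}
    (hφ : φ ∈ atlas (EuclideanSpace ℝ (Fin d)) M) {t : ℝ} (ht : t ∈ s) (hγt : γ t ∈ φ.source) :
    HasDerivWithinAt (φ ∘ γ) (chartField v φ (φ (γ t))) s t := by
  have h1 := (mdifferentiableAt_atlas (I := 𝓡 d) hφ hγt).hasMFDerivAt
  have h2 := h1.comp_hasMFDerivWithinAt t (hγ t ht)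
  have h3 := hasMFDerivWithinAt_iff_hasFDerivWithinAt.1 h2
  rw [chartField_apply v φ hγt]
  have key (L : ℝ →L[ℝ] EuclideanSpace ℝ (Fin d)) (w : EuclideanSpace ℝ (Fin d))
      (hL : HasFDerivWithinAt (φ ∘ γ) L s t) (hw : L 1 = w) :
      HasDerivWithinAt (φ ∘ γ) w s t := hw ▸ hL.hasDerivWithinAt
  exact key _ _ h3 (congrArg (mfderiv (𝓡 d) (𝓡 d) φ (γ t)) (one_smul ℝ (v (γ t))))

/-- Lifts solutions constructed in coordinates back to the manifold; it rests on the derivative of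
`φ.symm` undoing that of `φ`. -/
theorem isMIntegralCurveOn_chart_symm_comp [IsManifold (𝓡 d) ∞ M]
    {v : ∀ x : M, TangentSpace (𝓡 d) x}
    {φ : OpenPartialHomeomorph M (EuclideanSpace ℝ (Fin d))}
    (hφ : φ ∈ atlas (EuclideanSpace ℝ (Fin d)) M) {c : ℝ → EuclideanSpace ℝ (Fin d)} {s : Set ℝ}
    (hc : ∀ t ∈ s, HasDerivWithinAt c (chartField v φ (c t)) s t) (hcs : ∀ t ∈ s, c t ∈ φ.target) :
    IsMIntegralCurveOn (I := 𝓡 d) (φ.symm ∘ c) v s := by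
  intro t ht
  have h1 := (mdifferentiableAt_atlas_symm (I := 𝓡 d) hφ (hcs t ht)).hasMFDerivAt
  have h2 := h1.comp_hasMFDerivWithinAt t (hc t ht).hasFDerivWithinAt.hasMFDerivWithinAt
  refine h2.congr_mfderiv ?_
  have hinv := (mdifferentiable_of_mem_atlas (I := 𝓡 d) hφ).symm_comp_deriv
    (φ.map_target (hcs t ht))
  have key (p : EuclideanSpace ℝ (Fin d)) (hp : p = c t) (w : EuclideanSpace ℝ (Fin d)) :
      (mfderiv (𝓡 d) (𝓡 d) φ.symm p w : EuclideanSpace ℝ (Fin d))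
        = (mfderiv (𝓡 d) (𝓡 d) φ.symm (c t) w : EuclideanSpace ℝ (Fin d)) := by rw [hp]
  refine ContinuousLinearMap.ext_ring ?_
  have h3 := key _ (φ.right_inv (hcs t ht)) (chartField v φ (c t))
  have h4 := DFunLike.congr_fun hinv (v (φ.symm (c t)))
  have h5 : (mfderiv (𝓡 d) (𝓡 d) φ.symm (c t) (chartField v φ (c t)) : EuclideanSpace ℝ (Fin d))
      = v (φ.symm (c t)) := h3.symm.trans h4
  have h6 : (ContinuousLinearMap.toSpanSingleton ℝ (chartField v φ (c t))) (1 : ℝ)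
      = chartField v φ (c t) := by simp
  refine Eq.trans (congrArg (mfderiv (𝓡 d) (𝓡 d) φ.symm (c t)) h6) (h5.trans ?_)
  exact (one_smul ℝ (v (φ.symm (c t)))).symm

/-- Two integral curves of a `C¹` vector field that agree at one time agree at all times. -/
theorem IsMIntegralCurveOn.eqOn_Icc [IsManifold (𝓡 d) ∞ M] [T2Space M]
    {v : ∀ x : M, TangentSpace (𝓡 d) x}
    (hv : ∀ φ ∈ atlas (EuclideanSpace ℝ (Fin d)) M, ContDiffOn ℝ 1 (chartField v φ) φ.target)
    {γ₁ γ₂ : ℝ → M} {a b : ℝ} (h₁ : IsMIntegralCurveOn (I := 𝓡 d) γ₁ v (Icc a b))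
    (h₂ : IsMIntegralCurveOn (I := 𝓡 d) γ₂ v (Icc a b)) {t₀ : ℝ} (ht₀ : t₀ ∈ Icc a b)
    (heq : γ₁ t₀ = γ₂ t₀) : EqOn γ₁ γ₂ (Icc a b) := by
  intro t ht
  -- Agreement is locally constant in time: disagreement is open by the Hausdorff property,
  -- agreement by Lipschitz uniqueness in a chart, forwards and backwards.
  refine (isPreconnected_Icc.induction₂ (fun s t => γ₁ s = γ₂ s ↔ γ₁ t = γ₂ t) (fun s hs => ?_)
    (fun _ _ _ _ _ _ h h' => h.trans h') (fun _ _ _ _ h => h.symm) ht₀ ht).1 heq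
  have hc₁ : ContinuousWithinAt γ₁ (Icc a b) s := (h₁ s hs).continuousWithinAt
  have hc₂ : ContinuousWithinAt γ₂ (Icc a b) s := (h₂ s hs).continuousWithinAt
  by_cases hs12 : γ₁ s = γ₂ s
  swap
  · have := (hc₁.tendsto.prodMk_nhds hc₂.tendsto).eventually
      (isClosed_diagonal.isOpen_compl.mem_nhds (show (γ₁ s, γ₂ s) ∈ (diagonal M)ᶜ from hs12))
    filter_upwards [this] with t ht
    exact iff_of_false hs12 ht
  set φ := chartAt (EuclideanSpace ℝ (Fin d)) (γ₁ s) with hφ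
  have hφa : φ ∈ atlas (EuclideanSpace ℝ (Fin d)) M := chart_mem_atlas _ _
  have hsrc : γ₁ s ∈ φ.source := mem_chart_source _ _
  obtain ⟨K, N, hN, hK⟩ := ((hv φ hφa).contDiffAt
    (φ.open_target.mem_nhds (φ.map_source hsrc))).exists_lipschitzOnWith
  have hN' : φ.source ∩ φ ⁻¹' N ∈ 𝓝 (γ₁ s) :=
    Filter.inter_mem (φ.open_source.mem_nhds hsrc) ((φ.continuousAt hsrc).preimage_mem_nhds hN)
  have hev : ∀ᶠ t in 𝓝[Icc a b] s, (γ₁ t ∈ φ.source ∩ φ ⁻¹' N) ∧ (γ₂ t ∈ φ.source ∩ φ ⁻¹' N) :=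
    Filter.inter_mem (hc₁.preimage_mem_nhdsWithin hN')
      (hc₂.preimage_mem_nhdsWithin (hs12 ▸ hN'))
  obtain ⟨ε, hε, hball⟩ := Metric.mem_nhdsWithin_iff.1 hev
  filter_upwards [inter_mem_nhdsWithin (Icc a b) (Metric.ball_mem_nhds s hε)] with t ht
  simp only [hs12, true_iff]
  have hsub : uIcc s t ⊆ Metric.ball s ε ∩ Icc a b := fun u hu =>
    ⟨(convex_ball s ε).ordConnected.uIcc_subset (Metric.mem_ball_self hε) ht.2 hu,
      ordConnected_Icc.uIcc_subset hs ht.1 hu⟩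
  have hm (u) (hu : u ∈ uIcc s t) := hball (hsub hu)
  have hφeq : φ (γ₁ t) = φ (γ₂ t) := by
    rcases le_total s t with hst | hst
    · rw [uIcc_of_le hst] at hm hsub
      refine ODE_solution_unique_of_mem_Icc_right (v := fun _ => chartField v φ) (s := fun _ => N)
        (K := K) (f := φ ∘ γ₁) (g := φ ∘ γ₂) (a := s) (b := t) (fun _ _ => hK)
        (fun u hu => ((h₁.hasDerivWithinAt_chart hφa (hsub hu).2
          (hm u hu).1.1).continuousWithinAt).mono fun w hw => (hsub hw).2)
        (fun u hu => ?_) (fun u hu => (hm u (Ico_subset_Icc_self hu)).1.2)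
        (fun u hu => ((h₂.hasDerivWithinAt_chart hφa (hsub hu).2
          (hm u hu).2.1).continuousWithinAt).mono fun w hw => (hsub hw).2)
        (fun u hu => ?_) (fun u hu => (hm u (Ico_subset_Icc_self hu)).2.2)
        (congrArg φ hs12) (right_mem_Icc.2 hst)
      · have hu' := Ico_subset_Icc_self hu
        exact (h₁.hasDerivWithinAt_chart hφa (hsub hu').2 (hm u hu').1.1).Ici_of_Icc
          ⟨(hsub hu').2.1, hu.2.trans_le ht.1.2⟩
      · have hu' := Ico_subset_Icc_self hu
        exact (h₂.hasDerivWithinAt_chart hφa (hsub hu').2 (hm u hu').2.1).Ici_of_Icc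
          ⟨(hsub hu').2.1, hu.2.trans_le ht.1.2⟩
    · rw [uIcc_of_ge hst] at hm hsub
      refine ODE_solution_unique_of_mem_Icc_left (v := fun _ => chartField v φ) (s := fun _ => N)
        (K := K) (f := φ ∘ γ₁) (g := φ ∘ γ₂) (a := t) (b := s) (fun _ _ => hK)
        (fun u hu => ((h₁.hasDerivWithinAt_chart hφa (hsub hu).2
          (hm u hu).1.1).continuousWithinAt).mono fun w hw => (hsub hw).2)
        (fun u hu => ?_) (fun u hu => (hm u (Ioc_subset_Icc_self hu)).1.2)
        (fun u hu => ((h₂.hasDerivWithinAt_chart hφa (hsub hu).2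
          (hm u hu).2.1).continuousWithinAt).mono fun w hw => (hsub hw).2)
        (fun u hu => ?_) (fun u hu => (hm u (Ioc_subset_Icc_self hu)).2.2)
        (congrArg φ hs12) (left_mem_Icc.2 hst)
      · have hu' := Ioc_subset_Icc_self hu
        exact (h₁.hasDerivWithinAt_chart hφa (hsub hu').2 (hm u hu').1.1).Iic_of_Icc
          ⟨ht.1.1.trans_lt hu.1, (hsub hu').2.2⟩
      · have hu' := Ioc_subset_Icc_self hu
        exact (h₂.hasDerivWithinAt_chart hφa (hsub hu').2 (hm u hu').2.1).Iic_of_Icc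
          ⟨ht.1.1.trans_lt hu.1, (hsub hu').2.2⟩
  have htm := hball ⟨ht.2, ht.1⟩
  exact φ.injOn htm.1.1 htm.2.1 hφeq

end ChartField

/-! ### Hamilton's equation in charts and conservation of energy -/

section Hamiltonian

set_option maxSynthPendingDepth 3

open ContinuousAlternatingMap

/-- If `X` solves `w(X, ·) = α` for a nondegenerate 2-form `w`, then `X` is as smooth as `w`
and `α`. -/
theorem contDiffOn_of_toBilin_eq {E : Type*} [NormedAddCommGroup E] [NormedSpace ℝ E]
    [FiniteDimensional ℝ E] {n : WithTop ℕ∞} {Ω : Set E} {w : E → E [⋀^Fin 2]→L[ℝ] ℝ}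
    {α : E → E →L[ℝ] ℝ} {X : E → E} (hw : ContDiffOn ℝ n w Ω) (hα : ContDiffOn ℝ n α Ω)
    (hnd : ∀ y ∈ Ω, ∀ u, (∀ v, w y ![u, v] = 0) → u = 0)
    (hX : ∀ y ∈ Ω, toBilin (w y) (X y) = α y) : ContDiffOn ℝ n X Ω := by
  have : CompleteSpace E := FiniteDimensional.complete ℝ E
  have hfr : Module.finrank ℝ E = Module.finrank ℝ (E →L[ℝ] ℝ) := by
    rw [← (LinearMap.toContinuousLinearMap (𝕜 := ℝ) (E := E) (F' := ℝ)).finrank_eq]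
    exact Subspace.dual_finrank_eq.symm
  have hinv : ∀ y ∈ Ω, ∃ e : E ≃L[ℝ] (E →L[ℝ] ℝ), (e : E →L[ℝ] E →L[ℝ] ℝ) = toBilin (w y) := by
    intro y hy
    have hinj : Function.Injective (toBilin (w y)).toLinearMap := by
      refine (injective_iff_map_eq_zero _).2 fun u hu => hnd y hy u fun v => ?_
      rw [← toBilin_apply]
      exact DFunLike.congr_fun hu v
    refine ⟨(LinearEquiv.ofInjectiveOfFinrankEq _ hinj hfr).toContinuousLinearEquiv, ?_⟩
    ext u v
    rfl
  have hB : ContDiffOn ℝ n (fun y => toBilin (w y)) Ω := contDiff_toBilin.comp_contDiffOn hw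
  -- Inversion of operators is smooth at invertible ones, and `X` is this inverse applied to `α`.
  have hI : ContDiffOn ℝ n (fun y => (toBilin (w y)).inverse) Ω := by
    intro y hy
    obtain ⟨e, he⟩ := hinv y hy
    have h1 := contDiffAt_map_inverse (𝕜 := ℝ) (n := n) e
    rw [he] at h1
    exact h1.comp_contDiffWithinAt y (hB y hy)
  refine (hI.clm_apply hα).congr fun y hy => ?_
  obtain ⟨e, he⟩ := hinv y hy
  rw [← hX y hy, ← he, ContinuousLinearMap.inverse_equiv]
  simp

namespace SymplecticForm

variable {d : ℕ} {M : Type*} [TopologicalSpace M] [ChartedSpace (EuclideanSpace ℝ (Fin d)) M]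

theorem contDiffOn_comp_chart_symm [IsManifold (𝓡 d) ∞ M] {H : M → ℝ}
    (hH : ContMDiff (𝓡 d) 𝓘(ℝ, ℝ) 2 H)
    {φ : OpenPartialHomeomorph M (EuclideanSpace ℝ (Fin d))}
    (hφ : φ ∈ atlas (EuclideanSpace ℝ (Fin d)) M) : ContDiffOn ℝ 2 (H ∘ φ.symm) φ.target := by
  refine contMDiffOn_iff_contDiffOn.1 (hH.comp_contMDiffOn ?_)
  exact contMDiffOn_symm_of_mem_maximalAtlas (IsManifold.subset_maximalAtlas hφ)

/-- Hamilton's equation in a chart. -/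
theorem toBilin_chartField [IsManifold (𝓡 d) ∞ M] (σ : SymplecticForm d M) {H : M → ℝ}
    (hH : ContMDiff (𝓡 d) 𝓘(ℝ, ℝ) 2 H)
    {φ : OpenPartialHomeomorph M (EuclideanSpace ℝ (Fin d))}
    (hφ : φ ∈ atlas (EuclideanSpace ℝ (Fin d)) M) {y : EuclideanSpace ℝ (Fin d)}
    (hy : y ∈ φ.target) :
    toBilin (coordForm σ.toFun φ y) (chartField (σ.hamiltonianVectorField H) φ y)
      = fderiv ℝ (H ∘ φ.symm) y := by
  ext w
  have h1 := (mdifferentiableAt_atlas_symm (I := 𝓡 d) hφ hy).hasMFDerivAt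
  have h2 := ((hH.mdifferentiable two_ne_zero) (φ.symm y)).hasMFDerivAt
  have hfd (L : EuclideanSpace ℝ (Fin d) →L[ℝ] ℝ) (hL : HasFDerivAt (H ∘ φ.symm) L y) :
      L w = fderiv ℝ (H ∘ φ.symm) y w := by rw [hL.fderiv]
  have h3 := hfd _ (hasMFDerivAt_iff_hasFDerivAt.1 (h2.comp y h1))
  have hinv := (mdifferentiable_of_mem_atlas (I := 𝓡 d) hφ).symm_comp_deriv (φ.map_target hy)
  have key (p : EuclideanSpace ℝ (Fin d)) (hp : p = y) (w : EuclideanSpace ℝ (Fin d)) :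
      (mfderiv (𝓡 d) (𝓡 d) φ.symm p w : EuclideanSpace ℝ (Fin d))
        = (mfderiv (𝓡 d) (𝓡 d) φ.symm y w : EuclideanSpace ℝ (Fin d)) := by rw [hp]
  have h5 : (mfderiv (𝓡 d) (𝓡 d) φ.symm y (chartField (σ.hamiltonianVectorField H) φ y) :
      EuclideanSpace ℝ (Fin d)) = σ.hamiltonianVectorField H (φ.symm y) :=
    (key _ (φ.right_inv hy) _).symm.trans
      (DFunLike.congr_fun hinv (σ.hamiltonianVectorField H (φ.symm y)))
  have h6 := σ.apply_hamiltonianVectorField H (φ.symm y)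
    (mfderiv (𝓡 d) (𝓡 d) φ.symm y w : EuclideanSpace ℝ (Fin d))
  rw [toBilin_apply]
  refine Eq.trans (Eq.trans ?_ h6) h3
  refine congrArg (σ.toFun (φ.symm y)) ?_
  ext i
  fin_cases i
  · exact h5
  · rfl

theorem coordForm_nondegenerate [IsManifold (𝓡 d) ∞ M] (σ : SymplecticForm d M)
    {φ : OpenPartialHomeomorph M (EuclideanSpace ℝ (Fin d))}
    (hφ : φ ∈ atlas (EuclideanSpace ℝ (Fin d)) M) {y : EuclideanSpace ℝ (Fin d)}
    (hy : y ∈ φ.target) (u : EuclideanSpace ℝ (Fin d))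
    (hu : ∀ v, coordForm σ.toFun φ y ![u, v] = 0) : u = 0 := by
  have hbij := (mdifferentiable_of_mem_atlas (I := 𝓡 d) hφ).symm.mfderiv_bijective hy
  have h0 : mfderiv (𝓡 d) (𝓡 d) φ.symm y u = 0 := by
    refine σ.nondegenerate _ _ fun w => ?_
    obtain ⟨v, rfl⟩ := hbij.2 w
    refine Eq.trans ?_ (hu v)
    refine congrArg (σ.toFun (φ.symm y)) ?_
    ext i
    fin_cases i <;> rfl
  exact hbij.1 (h0.trans (_root_.map_zero _).symm)

/-- The form is smooth and dH is C¹ when `H` is C², so solving for the field loses just one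
derivative. C¹ is what both uniqueness and the differentiable flow require. -/
theorem contDiffOn_chartField [IsManifold (𝓡 d) ∞ M] (σ : SymplecticForm d M) {H : M → ℝ}
    (hH : ContMDiff (𝓡 d) 𝓘(ℝ, ℝ) 2 H) :
    ∀ φ ∈ atlas (EuclideanSpace ℝ (Fin d)) M,
      ContDiffOn ℝ 1 (chartField (σ.hamiltonianVectorField H) φ) φ.target := fun φ hφ =>
  contDiffOn_of_toBilin_eq ((σ.smooth φ hφ).of_le (mod_cast le_top))
    ((contDiffOn_comp_chart_symm hH hφ).fderiv_of_isOpen φ.open_target le_rfl)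
    (fun _ hy => σ.coordForm_nondegenerate hφ hy) (fun _ hy => σ.toBilin_chartField hH hφ hy)

/-- The Hamiltonian is conserved along its integral curves. -/
theorem hamiltonian_eq_of_isMIntegralCurveOn (σ : SymplecticForm d M)
    {H : M → ℝ} (hH : MDifferentiable (𝓡 d) 𝓘(ℝ, ℝ) H) {γ : ℝ → M} {T : ℝ}
    (hγ : IsMIntegralCurveOn (I := 𝓡 d) γ (σ.hamiltonianVectorField H) (Icc 0 T)) {t : ℝ}
    (ht : t ∈ Icc 0 T) : H (γ t) = H (γ 0) := by
  have hder : ∀ t ∈ Icc 0 T, HasDerivWithinAt (H ∘ γ) 0 (Icc 0 T) t := by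
    intro t ht
    have h2 := (hH (γ t)).hasMFDerivAt.comp_hasMFDerivWithinAt t (hγ t ht)
    have key (L : ℝ →L[ℝ] ℝ) (hL : HasFDerivWithinAt (H ∘ γ) L (Icc 0 T) t) (hw : L 1 = 0) :
        HasDerivWithinAt (H ∘ γ) 0 (Icc 0 T) t := hw ▸ hL.hasDerivWithinAt
    refine key _ (hasMFDerivWithinAt_iff_hasFDerivWithinAt.1 h2) ?_
    refine (congrArg (mfderiv (𝓡 d) 𝓘(ℝ, ℝ) H (γ t))
      (one_smul ℝ (σ.hamiltonianVectorField H (γ t)))).trans ?_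
    rw [← σ.apply_hamiltonianVectorField]
    exact (σ.toFun (γ t)).map_eq_zero_of_eq _ (i := 0) (j := 1) rfl (by decide)
  exact constant_of_has_deriv_right_zero (fun t ht => (hder t ht).continuousWithinAt)
    (fun t ht => (hder t (Ico_subset_Icc_self ht)).Ici_of_Icc ht) t ht

end SymplecticForm

end Hamiltonian

/-! ### Liouville's theorem for short times -/

/-- `F` maps the measurable subsets of `O` to measurable sets of the same volume. -/
def PreservesVolumeOn {M : Type*} [MeasurableSpace M] (μ : Measure M) (F : M → M) (O : Set M) :
    Prop :=
  ∀ C ⊆ O, MeasurableSet C → MeasurableSet (F '' C) ∧ μ (F '' C) = μ C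

/-- Near `x`, the time-`t` evolution under `v` is given by a continuous volume-preserving map. -/
def HasVolumePreservingEvolution {d : ℕ} {M : Type*} [TopologicalSpace M]
    [ChartedSpace (EuclideanSpace ℝ (Fin d)) M] [MeasurableSpace M] (μ : Measure M)
    (v : ∀ x : M, TangentSpace (𝓡 d) x) (x : M) (t : ℝ) : Prop :=
  ∃ (O : Set M) (F : M → M), IsOpen O ∧ x ∈ O ∧ ContinuousOn F O ∧ PreservesVolumeOn μ F O ∧
    ∀ γ : ℝ → M, γ 0 ∈ O → IsMIntegralCurveOn (I := 𝓡 d) γ v (Icc 0 t) → γ t = F (γ 0)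

namespace SymplecticForm

variable {d : ℕ} {M : Type*} [TopologicalSpace M] [ChartedSpace (EuclideanSpace ℝ (Fin d)) M]

/-- **Liouville's theorem**, for short times and near a given point. -/
theorem exists_nhds_hasVolumePreservingEvolution [IsManifold (𝓡 d) ∞ M] [T2Space M]
    [MeasurableSpace M] [BorelSpace M] (σ : SymplecticForm d M) {H : M → ℝ}
    (hH : ContMDiff (𝓡 d) 𝓘(ℝ, ℝ) 2 H) (p : M) :
    ∃ W : Set M, IsOpen W ∧ p ∈ W ∧ ∃ T > 0, ∀ x ∈ W, ∀ t ∈ Icc 0 T,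
      HasVolumePreservingEvolution σ.liouvilleMeasure (σ.hamiltonianVectorField H) x t := by
  set φ := chartAt (EuclideanSpace ℝ (Fin d)) p with hφdef
  have hφ : φ ∈ atlas (EuclideanSpace ℝ (Fin d)) M := chart_mem_atlas _ _
  have hp : p ∈ φ.source := mem_chart_source _ _
  set X := chartField (σ.hamiltonianVectorField H) φ with hXdef
  have hX := σ.contDiffOn_chartField hH φ hφ
  obtain ⟨W, hW, hpW, T, hT, Φ, V, s, L, hs, hlip, hflow⟩ :=
    exists_local_flow_hasFDerivAt φ.open_target hX (φ.map_source hp)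
  refine ⟨φ.source ∩ φ ⁻¹' W, φ.isOpen_inter_preimage hW, ⟨hp, hpW⟩, T, hT, fun x hx t ht => ?_⟩
  have hcont : ContinuousOn (fun y => Φ y t) W := fun y hy =>
    ((hflow y hy).2.2 t ht).2.2.2.continuousAt.continuousWithinAt
  have hmaps : ∀ y ∈ W, Φ y t ∈ φ.target := fun y hy => hs ((hflow y hy).2.2 t ht).1
  have hinj : InjOn (fun y => Φ y t) W := by
    intro y hy z hz hyz
    have hsub : Icc 0 t ⊆ Icc 0 T := Icc_subset_Icc_right ht.2
    have hder (y) (hy : y ∈ W) (u) (hu : u ∈ Icc 0 t) :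
        HasDerivWithinAt (Φ y) (X (Φ y u)) (Icc 0 t) u :=
      (((hflow y hy).2.2 u (hsub hu)).2.1).mono hsub
    have := ODE_solution_unique_of_mem_Icc_left (v := fun _ => X) (s := fun _ => s) (K := L)
      (f := Φ y) (g := Φ z) (a := 0) (b := t) (fun _ _ => hlip)
      (fun u hu => (hder y hy u hu).continuousWithinAt)
      (fun u hu => (hder y hy u (Ioc_subset_Icc_self hu)).Iic_of_Icc hu)
      (fun u hu => ((hflow y hy).2.2 u (hsub (Ioc_subset_Icc_self hu))).1)
      (fun u hu => (hder z hz u hu).continuousWithinAt)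
      (fun u hu => (hder z hz u (Ioc_subset_Icc_self hu)).Iic_of_Icc hu)
      (fun u hu => ((hflow z hz).2.2 u (hsub (Ioc_subset_Icc_self hu))).1) hyz
      (left_mem_Icc.2 ht.1)
    rwa [(hflow y hy).1, (hflow z hz).1] at this
  refine ⟨φ.source ∩ φ ⁻¹' W, fun x => φ.symm (Φ (φ x) t), φ.isOpen_inter_preimage hW, hx,
    ?_, fun C hC hCm => ?_, fun γ hγ0 hγ => ?_⟩
  · refine φ.continuousOn_symm.comp (hcont.comp (φ.continuousOn.mono inter_subset_left)
      fun x hx => hx.2) fun x hx => hmaps _ hx.2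
  · have hCs : C ⊆ φ.source := fun x hx => (hC hx).1
    have hD : MeasurableSet (φ '' C) := φ.measurableSet_image hCm hCs
    have hDW : φ '' C ⊆ W := by
      rintro _ ⟨x, hx, rfl⟩
      exact (hC hx).2
    set D' := (fun y => Φ y t) '' (φ '' C) with hD'
    have hder : ∀ y ∈ φ '' C, HasFDerivWithinAt (fun y => Φ y t) (V y t) (φ '' C) y :=
      fun y hy => ((hflow y (hDW hy)).2.2 t ht).2.2.2.hasFDerivWithinAt
    have hD'm : MeasurableSet D' := measurable_image_of_fderivWithin hD hder (hinj.mono hDW)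
    have hD't : D' ⊆ φ.target := by
      rintro _ ⟨y, hy, rfl⟩
      exact hmaps y (hDW hy)
    have himg : (fun x => φ.symm (Φ (φ x) t)) '' C = φ.symm '' D' := by
      rw [hD', image_image, image_image]
    have hm : MeasurableSet (φ.symm '' D') := φ.symm.measurableSet_image hD'm hD't
    rw [himg]
    refine ⟨hm, ?_⟩
    have hss : φ.symm '' D' ⊆ φ.source := by
      rintro _ ⟨y, hy, rfl⟩
      exact φ.map_target (hD't hy)
    have hback : φ '' (φ.symm '' D') = D' := by
      rw [image_image]
      exact (image_congr fun y hy => φ.right_inv (hD't hy)).trans (image_id' D')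
    rw [σ.liouvilleMeasure_apply_of_subset hφ hm hss, hback,
      σ.liouvilleMeasure_apply_of_subset hφ hCm hCs]
    refine lintegral_image_formDensity hD hder (hinj.mono hDW) fun y hy => ?_
    have hfl := hflow y (hDW hy)
    -- The derivative of the time-`t` map is the linearised flow, so this invariance says that the
    -- map pulls the coordinate form back to itself.
    have key := toBilin_linearised_flow_eq φ.open_target
      ((σ.smooth φ hφ).differentiableOn (by simp)) (σ.closed φ hφ)
      (contDiffOn_comp_chart_symm hH hφ) (hX.differentiableOn one_ne_zero)
      (fun y hy => σ.toBilin_chartField hH hφ hy) (fun u hu => hs (hfl.2.2 u hu).1)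
      (fun u hu => (hfl.2.2 u hu).2.1) (fun u hu => (hfl.2.2 u hu).2.2.1) hfl.2.1 ht
    ext w
    have hw := key (w 0) (w 1)
    rw [ContinuousAlternatingMap.toBilin_apply, ContinuousAlternatingMap.toBilin_apply,
      hfl.1] at hw
    refine Eq.trans (congrArg _ ?_) (hw.symm.trans (congrArg _ ?_))
    · ext1 i; fin_cases i <;> rfl
    · ext1 i; fin_cases i <;> rfl
  · have hfl := hflow (φ (γ 0)) hγ0.2
    have hsub : Icc 0 t ⊆ Icc 0 T := Icc_subset_Icc_right ht.2
    have hcurve := isMIntegralCurveOn_chart_symm_comp (v := σ.hamiltonianVectorField H) hφ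
      (c := Φ (φ (γ 0))) (s := Icc 0 t)
      (fun u hu => ((hfl.2.2 u (hsub hu)).2.1).mono hsub) (fun u hu => hs (hfl.2.2 u (hsub hu)).1)
    -- Uniqueness on the manifold is used, so `γ` need not be known in advance to stay in the chart.
    refine hγ.eqOn_Icc (σ.contDiffOn_chartField hH) hcurve (left_mem_Icc.2 ht.1) ?_
      (right_mem_Icc.2 ht.1)
    rw [Function.comp_apply, hfl.1, φ.left_inv hγ0.1]

end SymplecticForm

theorem PreservesVolumeOn.comp {M : Type*} [MeasurableSpace M] {μ : Measure M}
    {F G : M → M} {O P : Set M} (hF : PreservesVolumeOn μ F O)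
    (hG : PreservesVolumeOn μ G P) : PreservesVolumeOn μ (G ∘ F) (O ∩ F ⁻¹' P) := by
  intro C hC hCm
  have h1 := hF C (fun x hx => (hC hx).1) hCm
  have h2 := hG (F '' C) (by rintro _ ⟨x, hx, rfl⟩; exact (hC hx).2) h1.1
  rw [image_comp]
  exact ⟨h2.1, h2.2.trans h1.2⟩

/-! ### Propagation to long times along a trajectory -/

section Evolution

variable {d : ℕ} {M : Type*} [TopologicalSpace M] [ChartedSpace (EuclideanSpace ℝ (Fin d)) M]
  [MeasurableSpace M] {μ : Measure M} {v : ∀ x : M, TangentSpace (𝓡 d) x}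

theorem hasVolumePreservingEvolution_zero (x : M) : HasVolumePreservingEvolution μ v x 0 :=
  ⟨univ, id, isOpen_univ, mem_univ x, continuousOn_id, fun C _ hC => by simpa using hC,
    fun _ _ _ => rfl⟩

/-- The curve `γ` only locates the intermediate point. A nearby curve lasting to time s + t is cut
at `s`, and its second half, shifted to start at 0, is handled by the second local map. -/
theorem HasVolumePreservingEvolution.add {γ : ℝ → M} {s t : ℝ} (hs : 0 ≤ s) (ht : 0 ≤ t)
    (hγ : IsMIntegralCurveOn (I := 𝓡 d) γ v (Icc 0 s))
    (h₁ : HasVolumePreservingEvolution μ v (γ 0) s)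
    (h₂ : HasVolumePreservingEvolution μ v (γ s) t) :
    HasVolumePreservingEvolution μ v (γ 0) (s + t) := by
  obtain ⟨O, F, hO, hxO, hFc, hF, hFγ⟩ := h₁
  obtain ⟨P, G, hP, hxP, hGc, hG, hGγ⟩ := h₂
  refine ⟨O ∩ F ⁻¹' P, G ∘ F, hFc.isOpen_inter_preimage hO hP, ⟨hxO, ?_⟩,
    hGc.comp (hFc.mono inter_subset_left) fun x hx => hx.2, hF.comp hG, fun γ' hγ'0 hγ' => ?_⟩
  · rw [mem_preimage, ← hFγ γ hxO hγ]
    exact hxP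
  · have h1 := hFγ γ' hγ'0.1 (hγ'.mono (Icc_subset_Icc_right (by linarith)))
    have h2 : IsMIntegralCurveOn (I := 𝓡 d) (γ' ∘ (· + s)) v (Icc 0 t) :=
      (hγ'.comp_add s).mono fun u hu => ⟨by linarith [hu.1], by linarith [hu.2]⟩
    have h3 := hGγ _ (by simpa [h1] using hγ'0.2) h2
    simpa [h1, add_comm] using h3

/-- Short-time volume preservation near every point propagates along integral curves. -/
theorem hasVolumePreservingEvolution_of_isMIntegralCurveOn
    (hloc : ∀ p : M, ∃ W : Set M, IsOpen W ∧ p ∈ W ∧ ∃ T > 0, ∀ x ∈ W, ∀ t ∈ Icc 0 T,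
      HasVolumePreservingEvolution μ v x t) {γ : ℝ → M} {τ : ℝ} (hτ : 0 ≤ τ)
    (hγ : IsMIntegralCurveOn (I := 𝓡 d) γ v (Icc 0 τ)) :
    HasVolumePreservingEvolution μ v (γ 0) τ := by
  choose W hW hpW T hT hWT using hloc
  have hcont : Continuous fun u : Icc 0 τ => γ u :=
    continuousOn_iff_continuous_domRestrict.1 fun t ht => (hγ t ht).continuousWithinAt
  -- Radius T / 2 makes any two times in one piece differ by less than T, so each step of the
  -- partition is within the reach of the short-time result.
  let c : Icc 0 τ → Set (Icc 0 τ) := fun u =>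
    (fun w : Icc 0 τ => γ w) ⁻¹' W (γ u) ∩ Metric.ball u (T (γ u) / 2)
  obtain ⟨t, ht0, htm, ⟨m, hm⟩, htc⟩ := exists_monotone_Icc_subset_open_cover_Icc hτ (c := c)
    (fun u => ((hW _).preimage hcont).inter Metric.isOpen_ball)
    (fun u _ => mem_iUnion.2 ⟨u, hpW _, Metric.mem_ball_self (half_pos (hT _))⟩)
  have hind : ∀ n, HasVolumePreservingEvolution μ v (γ 0) (t n) := by
    intro n
    induction n with
    | zero => rw [ht0]; exact hasVolumePreservingEvolution_zero _
    | succ n ih =>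
      obtain ⟨u, hu⟩ := htc n
      have hle : t n ≤ t (n + 1) := htm n.le_succ
      have h1 := hu (left_mem_Icc.2 hle)
      have h2 := hu (right_mem_Icc.2 hle)
      have hdist : dist (t (n + 1)) (t n) ≤ T (γ u) := by
        have := dist_triangle_right (t (n + 1)) (t n) u
        have h3 := Metric.mem_ball.1 h1.2
        have h4 := Metric.mem_ball.1 h2.2
        linarith
      have hle' : (t n : ℝ) ≤ t (n + 1) := hle
      have hd : (t (n + 1) : ℝ) - t n ≤ T (γ u) := (le_abs_self _).trans hdist
      have h5 := hWT (γ u) (γ (t n)) h1.1 _ ⟨sub_nonneg.2 hle', hd⟩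
      have h6 := ih.add (t n).2.1 (sub_nonneg.2 hle')
        (hγ.mono (Icc_subset_Icc_right (t n).2.2)) h5
      rwa [add_sub_cancel] at h6
  simpa [hm m le_rfl] using hind m

end Evolution

/-! ### From local volume preservation to recurrence -/

section Recurrence

/-- An injective map that preserves volume near every point of `B` preserves volume on `B`. -/
theorem preservesVolumeOn_of_locally {M : Type*} [TopologicalSpace M] [SecondCountableTopology M]
    [MeasurableSpace M] [OpensMeasurableSpace M] {μ : Measure M} {U : M → M} {B : Set M}
    (hinj : InjOn U B)
    (hloc : ∀ x ∈ B, ∃ O : Set M, IsOpen O ∧ x ∈ O ∧ PreservesVolumeOn μ U (O ∩ B)) :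
    PreservesVolumeOn μ U B := by
  intro C hCB hC
  choose! O hO hxO hOU using hloc
  obtain ⟨t, htB, htc, hBt⟩ := TopologicalSpace.countable_cover_nhdsWithin (s := B) (f := O)
    fun x hx => mem_nhdsWithin_of_mem_nhds ((hO x hx).mem_nhds (hxO x hx))
  rcases t.eq_empty_or_nonempty with rfl | hne
  · have : C = ∅ := subset_empty_iff.1 (hCB.trans (by simpa using hBt))
    simp [this]
  obtain ⟨e, rfl⟩ := htc.exists_eq_range hne
  -- Disjoint pieces of `C` have disjoint images because `U` is injective on `B`, so countable
  -- additivity applies on both sides.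
  set D : ℕ → Set M := disjointed fun n => O (e n) with hD
  have hDm (n) : MeasurableSet (C ∩ D n) :=
    hC.inter (MeasurableSet.disjointed (fun n => (hO _ (htB ⟨n, rfl⟩)).measurableSet) n)
  have hCD : C = ⋃ n, C ∩ D n := by
    rw [← inter_iUnion, hD, iUnion_disjointed]
    refine (inter_eq_left.2 fun x hx => ?_).symm
    simpa using hBt (hCB hx)
  have hU (n) := hOU (e n) (htB ⟨n, rfl⟩) (C ∩ D n)
    (fun x hx => ⟨disjointed_subset _ n hx.2, hCB hx.1⟩) (hDm n)
  have himg : U '' C = ⋃ n, U '' (C ∩ D n) := by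
    conv_lhs => rw [hCD]
    exact image_iUnion
  have hdisj : Pairwise (Function.onFun Disjoint fun n => C ∩ D n) := fun i j hij =>
    (disjoint_disjointed (fun n => O (e n)) hij).mono inter_subset_right inter_subset_right
  have hdisj' : Pairwise (Function.onFun Disjoint fun n => U '' (C ∩ D n)) := fun i j hij =>
    disjoint_image_image fun x hx y hy hxy => (hdisj hij).ne_of_mem hx hy
      (hinj (hCB hx.1) (hCB hy.1) hxy)
  refine ⟨himg ▸ MeasurableSet.iUnion fun n => (hU n).1, ?_⟩
  rw [himg, measure_iUnion hdisj' fun n => (hU n).1]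
  conv_rhs => rw [hCD, measure_iUnion hdisj hDm]
  exact tsum_congr fun n => (hU n).2

/-- **Poincaré recurrence** for a map preserving the volume of images of a space of finite volume. -/
theorem PreservesVolumeOn.recurrentInVolume {S : Type*} [MeasurableSpace S] {μ : Measure S}
    [IsFiniteMeasure μ] {f : S → S} (hf : Measurable f)
    (hμ : PreservesVolumeOn μ f univ) : RecurrentInVolume μ f := by
  have hmp : MeasurePreserving f μ μ := by
    refine ⟨hf, Measure.ext fun A hA => ?_⟩
    -- The image of `f ⁻¹' A` is `A ∩ range f`. By finiteness the range, having full volume, has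
    -- null complement.
    have hr := hμ univ subset_rfl MeasurableSet.univ
    rw [Measure.map_apply hf hA, ← (hμ _ (subset_univ _) (hf hA)).2, image_preimage_eq_inter_range]
    refine measure_inter_conull ?_
    rw [← image_univ, measure_compl hr.1 (measure_ne_top _ _), hr.2, tsub_self]
  intro A hA
  -- A measure-preserving map of a finite measure is conservative; the threshold 1 excludes the
  -- trivial return at time 0.
  refine measure_mono_null ?_
    (hmp.conservative.measure_mem_forall_ge_image_notMem_eq_zero hA.nullMeasurableSet 1)
  exact fun x hx => ⟨hx.1, fun k hk => hx.2 k hk⟩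

end Recurrence

end

theorem theorem4 {n : ℕ} {M : Type*} [TopologicalSpace M]
    [ChartedSpace (EuclideanSpace ℝ (Fin (2 * n))) M] [IsManifold (𝓡 (2 * n)) ∞ M]
    [T2Space M] [SecondCountableTopology M] [MeasurableSpace M] [BorelSpace M]
    (σ : SymplecticForm (2 * n) M) (H : M → ℝ) (hH : ContMDiff (𝓡 (2 * n)) 𝓘(ℝ, ℝ) 2 H)
    (E δE : ℝ) (hδE : 0 < δE)
    (hfin : σ.liouvilleMeasure (energyBand H E δE) < ⊤)
    (τ : ℝ) (hτ : 0 < τ) (U : M → M)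
    (hU : σ.IsTimeEvolutionOn H τ U (energyBand H E δE)) :
    ∃ hmaps : MapsTo U (energyBand H E δE) (energyBand H E δE),
      RecurrentInVolume (σ.liouvilleMeasure.comap ((↑) : energyBand H E δE → M))
        (hmaps.restrict U (energyBand H E δE) (energyBand H E δE)) := by
  set B := energyBand H E δE with hB
  set μ := σ.liouvilleMeasure
  have hBo : IsOpen B := isOpen_Ioo.preimage hH.continuous
  have hBm : MeasurableSet B := hBo.measurableSet
  have hτI : τ ∈ Icc 0 τ := right_mem_Icc.2 hτ.le
  have hmaps : MapsTo U B B := by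
    intro x hx
    obtain ⟨γ, h0, hγ, h1⟩ := hU x hx
    have := σ.hamiltonian_eq_of_isMIntegralCurveOn (hH.mdifferentiable two_ne_zero) hγ hτI
    rw [h0, h1] at this
    change H (U x) ∈ Ioo E (E + δE)
    rw [this]
    exact hx
  have hinj : InjOn U B := by
    intro x hx y hy hxy
    obtain ⟨γ, h0, hγ, h1⟩ := hU x hx
    obtain ⟨γ', h0', hγ', h1'⟩ := hU y hy
    -- The curves are matched at the final time τ and compared at time 0.
    have := hγ.eqOn_Icc (σ.contDiffOn_chartField hH) hγ' hτI (by rw [h1, h1', hxy])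
      (left_mem_Icc.2 hτ.le)
    rwa [h0, h0'] at this
  have hloc : ∀ x ∈ B, ∃ O : Set M, IsOpen O ∧ x ∈ O ∧ ContinuousOn U (O ∩ B) ∧
      PreservesVolumeOn μ U (O ∩ B) := by
    intro x hx
    obtain ⟨γ, h0, hγ, h1⟩ := hU x hx
    have hev := hasVolumePreservingEvolution_of_isMIntegralCurveOn (μ := μ)
      (σ.exists_nhds_hasVolumePreservingEvolution hH) hτ.le hγ
    rw [h0] at hev
    obtain ⟨O, F, hO, hxO, hFc, hF, hFγ⟩ := hev
    -- Only points of `B` are known to have solutions up to τ, so the local map is identified with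
    -- `U` there and not on all of `O`.
    have heq : EqOn U F (O ∩ B) := by
      intro y hy
      obtain ⟨γ', h0', hγ', h1'⟩ := hU y hy.2
      rw [← h1', hFγ γ' (by rw [h0']; exact hy.1) hγ', h0']
    refine ⟨O, hO, hxO, (hFc.mono inter_subset_left).congr heq, fun C hC hCm => ?_⟩
    rw [(heq.mono hC).image_eq]
    exact hF C (hC.trans inter_subset_left) hCm
  have hvol : PreservesVolumeOn μ U B := preservesVolumeOn_of_locally hinj fun x hx =>
    let ⟨O, hO, hxO, _, h⟩ := hloc x hx
    ⟨O, hO, hxO, h⟩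
  have hUc : ContinuousOn U B := by
    intro x hx
    obtain ⟨O, hO, hxO, hc, _⟩ := hloc x hx
    refine (hc x ⟨hxO, hx⟩).mono_of_mem_nhdsWithin ?_
    exact Filter.inter_mem (mem_nhdsWithin_of_mem_nhds (hO.mem_nhds hxO)) self_mem_nhdsWithin
  refine ⟨hmaps, ?_⟩
  have : IsFiniteMeasure (μ.comap ((↑) : B → M)) := by
    refine ⟨?_⟩
    rw [comap_subtype_coe_apply hBm, image_univ, Subtype.range_coe]
    exact hfin
  refine PreservesVolumeOn.recurrentInVolume (hUc.mapsToRestrict hmaps).measurable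
    fun C _ hC => ?_
  have himg : ((↑) : B → M) '' (hmaps.restrict U B B '' C) = U '' ((↑) '' C) := by
    rw [image_image, image_image]
    rfl
  have h := hvol ((↑) '' C) (by rintro _ ⟨x, _, rfl⟩; exact x.2) (hBm.subtype_image hC)
  refine ⟨?_, ?_⟩
  · rw [← preimage_image_eq (hmaps.restrict U B B '' C) Subtype.val_injective, himg]
    exact measurable_subtype_coe h.1
  · rw [comap_subtype_coe_apply hBm, comap_subtype_coe_apply hBm, himg]
    exact h.2
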